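/- Let $p, L \in \mathbb{N}$ and $r > 0$, and let $\mathbb{B}^p_r = \{x \in \mathbb{R}^p : \|x\|_2 \le r\}$. For a topological space $\mathcal{X}$ with its Borel $\sigma$-algebra, let $\mathscr{M}_{\le 1}(\mathcal{X})$ (resp. $\mathscr{P}(\mathcal{X})$) be the space of nonnegative Borel measures of total mass at most one (resp. Borel probability measures) on $\mathcal{X}$, with the weak$^*$ topology, generated by the maps $\mu \mapsto \int_{\mathcal{X}} f\, d\mu$ for bounded continuous $f : \mathcal{X} \to \mathbb{R}$. Define inductively $\mathcal{M}^0 = \mathbb{B}^p_r$, $\mathcal{H}^t = \prod_{i \le t} \mathcal{M}^i$ with the product topology, and $\mathcal{M}^{t+1} = \mathscr{M}_{\le 1}(\mathcal{H}^t)$; elements of $\mathcal{H}^t$ are the iterated degree measures (IDMs) of order $t$, and elements of $\mathscr{P}(\mathcal{H}^t)$ are the distributions of IDMs (DIDMs) of order $t$. Let $p_{t,t-1} : \mathcal{H}^t \to \mathcal{H}^{t-1}$ and $p_t : \mathcal{H}^t \to \mathcal{M}^t$ be the canonical projections. An $L$-layer MPNN model is a sequence $\varphi = (\varphi^{(t)})_{t=0}^{L}$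 of Lipschitz continuous maps $\varphi^{(0)} : \mathbb{R}^p \to \mathbb{R}^{d_0}$ and $\varphi^{(t)} : \mathbb{R}^{2 d_{t-1}} \to \mathbb{R}^{d_t}$ for $1 \le t \le L$, with arbitrary hidden dimensions $d_0, \dots, d_L \in \mathbb{N}$. A readout is a Lipschitz continuous map $\psi : \mathbb{R}^{d_L} \to \mathbb{R}^d$. The model defines functions $\mathfrak{h}(\varphi)^{(t)} : \mathcal{H}^t \to \mathbb{R}^{d_t}$ by $\mathfrak{h}(\varphi)^{(0)} = \varphi^{(0)}|_{\mathbb{B}^p_r}$ and, for $1 \le t \le L$, $$\mathfrak{h}(\varphi)^{(t)}_\tau = \varphi^{(t)}\Big(\mathfrak{h}(\varphi)^{(t-1)}_{p_{t,t-1}(\tau)},\ \int_{\mathcal{H}^{t-1}} \mathfrak{h}(\varphi)^{(t-1)}\, d p_t(\tau)\Big),$$ and, together with a readout, the function $\mathfrak{H}(\varphi,\psi,\cdot) : \mathscr{P}(\mathcal{H}^L) \to \mathbb{R}^d$, $\mathfrak{H}(\varphi,\psi,\nu) = \psi\big(\int_{\mathcal{H}^L} \mathfrak{h}(\varphi)^{(L)}\,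 d\nu\big)$. Let $\mathcal{N}^1_L$ be the set of all functions $\mathfrak{h}(\varphi)^{(L)} : \mathcal{H}^L \to \mathbb{R}$, where $\varphi$ ranges over the $L$-layer MPNN models with $d_L = 1$, and let $\mathcal{NN}^1_L$ be the set of all functions $\mathfrak{H}(\varphi,\psi,\cdot) : \mathscr{P}(\mathcal{H}^L) \to \mathbb{R}$, where $(\varphi,\psi)$ ranges over the $L$-layer MPNN models with readout and output dimension $d = 1$ (and arbitrary $d_L$). **Theorem (Universal Approximation).** The functions in $\mathcal{N}^1_L$ and in $\mathcal{NN}^1_L$ are continuous; the set $\mathcal{N}^1_L$ is uniformly dense in $C(\mathcal{H}^L, \mathbb{R})$, and the set $\mathcal{NN}^1_L$ is uniformly dense in $C(\mathscr{P}(\mathcal{H}^L), \mathbb{R})$. That is, for every continuous real function $F$ on $\mathcal{H}^L$ (resp. on $\mathscr{P}(\mathcal{H}^L)$) and every $\varepsilon > 0$ there is $g$ in $\mathcal{N}^1_L$ (resp. in $\mathcal{NN}^1_L$) with $|g(x) - F(x)| < \varepsilon$ for all $x$. -/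

import Mathlib

open MeasureTheory
open scoped NNReal

noncomputable section

/-- The Euclidean space `ℝ^n`. -/
abbrev Euc (n : ℕ) : Type := EuclideanSpace ℝ (Fin n)

/-- The nonnegative Borel measures of total mass at most one on `X`. -/
def SubProbMeasure (X : Type) [MeasurableSpace X] : Type :=
  {μ : FiniteMeasure X // μ.mass ≤ 1}

/-- The weak-star topology, i.e. the one generated by the maps `μ ↦ ∫ f dμ` for bounded
continuous `f`: the subspace topology inherited from Mathlib's `FiniteMeasure X`. -/
instance SubProbMeasure.instTopologicalSpace (X : Type) [TopologicalSpace X] [MeasurableSpace X]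
    [OpensMeasurableSpace X] : TopologicalSpace (SubProbMeasure X) :=
  inferInstanceAs (TopologicalSpace {μ : FiniteMeasure X // μ.mass ≤ 1})

/-- The underlying measure. -/
def SubProbMeasure.toMeasure {X : Type} [MeasurableSpace X] (μ : SubProbMeasure X) : Measure X :=
  (μ.val : Measure X)

/-- A topological space equipped with its Borel σ-algebra. -/
structure BorelTopSpace where
  carrier : Type
  [top : TopologicalSpace carrier]
  [meas : MeasurableSpace carrier]
  [borelSpace : BorelSpace carrier]

attribute [instance] BorelTopSpace.top BorelTopSpace.meas BorelTopSpace.borelSpace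

/-- A topological space with its Borel σ-algebra, as a bundled object. -/
def BorelTopSpace.ofTop (X : Type) [TopologicalSpace X] : BorelTopSpace :=
  letI : MeasurableSpace X := borel X
  haveI : BorelSpace X := ⟨rfl⟩
  { carrier := X }

/-- The spaces `H^L = ∏_{i ≤ L} M^i`, built as iterated binary products: `H^0 = M^0` is the closed
ball of radius `r` in `ℝ^p`, and `H^{L+1} = H^L × M^{L+1}` with `M^{L+1} = M_{≤1}(H^L)`; each is
given the product topology and the corresponding Borel σ-algebra. -/
def idmSpace (p : ℕ) (r : ℝ) : ℕ → BorelTopSpace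
  | 0 => { carrier := Metric.closedBall (0 : Euc p) r }
  | L + 1 => .ofTop ((idmSpace p r L).carrier × SubProbMeasure (idmSpace p r L).carrier)

/-- The space `H^L` of iterated degree measures of order `L`. -/
def IDM (p : ℕ) (r : ℝ) (L : ℕ) : Type := (idmSpace p r L).carrier

instance IDM.instTopologicalSpace (p : ℕ) (r : ℝ) (L : ℕ) : TopologicalSpace (IDM p r L) :=
  (idmSpace p r L).top

instance IDM.instMeasurableSpace (p : ℕ) (r : ℝ) (L : ℕ) : MeasurableSpace (IDM p r L) :=
  (idmSpace p r L).meas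

instance IDM.instBorelSpace (p : ℕ) (r : ℝ) (L : ℕ) : BorelSpace (IDM p r L) :=
  (idmSpace p r L).borelSpace

/-- An order-`0` iterated degree measure is a point of the ball, here seen in `ℝ^p`. -/
def IDM.attr {p : ℕ} {r : ℝ} (τ : IDM p r 0) : Euc p :=
  Subtype.val (p := fun x : Euc p => x ∈ Metric.closedBall (0 : Euc p) r) τ

/-- The canonical projection `H^{L+1} → H^L` forgetting the last entry. -/
def IDM.trunc {p : ℕ} {r : ℝ} {L : ℕ} (τ : IDM p r (L + 1)) : IDM p r L :=
  Prod.fst (α := IDM p r L) (β := SubProbMeasure (IDM p r L)) τ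

/-- The canonical projection `H^{L+1} → M^{L+1} = M_{≤1}(H^L)` to the last entry. -/
def IDM.last {p : ℕ} {r : ℝ} {L : ℕ} (τ : IDM p r (L + 1)) : SubProbMeasure (IDM p r L) :=
  Prod.snd (α := IDM p r L) (β := SubProbMeasure (IDM p r L)) τ

/-- Distributions of iterated degree measures of order `L`: the Borel probability measures on
`H^L`, with Mathlib's weak-star topology on `ProbabilityMeasure`. -/
abbrev DIDM (p : ℕ) (r : ℝ) (L : ℕ) : Type := ProbabilityMeasure (IDM p r L)

/-- `MPNNModel p L d` is the type of `L`-layer MPNN models with input feature dimension `p` and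
last hidden dimension `d_L = d` (the other hidden dimensions are arbitrary): sequences of Lipschitz
maps `φ⁰ : ℝ^p → ℝ^{d_0}` and `φᵗ : ℝ^{2 d_{t-1}} → ℝ^{d_t}` for `1 ≤ t ≤ L`. The Euclidean space
`ℝ^{2 n}` is realized as the `ℓ²`-product of two copies of `ℝ^n`. -/
inductive MPNNModel (p : ℕ) : ℕ → ℕ → Type
  | init {d₀ : ℕ} (φ₀ : Euc p → Euc d₀) (lip : ∃ K : ℝ≥0, LipschitzWith K φ₀) : MPNNModel p 0 d₀
  | layer {L d d' : ℕ} (φ : MPNNModel p L d) (u : WithLp 2 (Euc d × Euc d) → Euc d')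
      (lip : ∃ K : ℝ≥0, LipschitzWith K u) : MPNNModel p (L + 1) d'

/-- The hidden representation `h^{(L)} : H^L → ℝ^{d_L}` computed by an `L`-layer MPNN model:
`h^{(0)} = φ⁰` and `h^{(t)}(τ) = φᵗ (h^{(t-1)}(p_{t,t-1} τ), ∫ h^{(t-1)} d(p_t τ))`. -/
def MPNNModel.feature {p : ℕ} (r : ℝ) : {L d : ℕ} → MPNNModel p L d → IDM p r L → Euc d
  | _, _, .init φ₀ _, τ => φ₀ τ.attr
  | _, _, .layer φ u _, τ =>
      u (WithLp.toLp 2 (φ.feature r τ.trunc, ∫ σ, φ.feature r σ ∂τ.last.toMeasure))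

/-- The output on a distribution of iterated degree measures of an MPNN model with readout `ψ`. -/
def MPNNModel.output {p : ℕ} (r : ℝ) {L d d' : ℕ} (φ : MPNNModel p L d) (ψ : Euc d → Euc d')
    (ν : DIDM p r L) : Euc d' :=
  ψ (∫ τ, φ.feature r τ ∂(ν : Measure (IDM p r L)))

/-- The real-valued functions on `H^L` computed by `L`-layer MPNN models with `d_L = 1`
(identifying `ℝ^1` with `ℝ`). -/
def mpnnFunctions (p : ℕ) (r : ℝ) (L : ℕ) : Set (IDM p r L → ℝ) :=
  {g | ∃ φ : MPNNModel p L 1, ∀ τ, g τ = φ.feature r τ 0}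

/-- The real-valued functions on `P(H^L)` computed by `L`-layer MPNN models with a Lipschitz
readout into `ℝ^1` (identified with `ℝ`); the hidden dimensions, `d_L` included, are arbitrary. -/
def mpnnReadoutFunctions (p : ℕ) (r : ℝ) (L : ℕ) : Set (DIDM p r L → ℝ) :=
  {g | ∃ (d : ℕ) (φ : MPNNModel p L d) (ψ : Euc d → Euc 1),
    (∃ K : ℝ≥0, LipschitzWith K ψ) ∧ ∀ ν, g ν = φ.output r ψ ν 0}

/-- `S` is a subset of `C(X, ℝ)`, and it is dense there for uniform convergence on `X`. -/
def UniformlyDenseInC {X : Type} [TopologicalSpace X] (S : Set (X → ℝ)) : Prop :=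
  (∀ g ∈ S, Continuous g) ∧
    ∀ F : X → ℝ, Continuous F → ∀ ε : ℝ, 0 < ε → ∃ g ∈ S, ∀ x, |g x - F x| < ε

end

/-!
Both density statements are instances of the Stone–Weierstrass theorem on a compact space.

*Compactness.* By induction on `L`, the space `H^L` is compact and metrizable. If `X` is compact and
metrizable, then the measures of mass at most one on `X` form a compact space by the
Riesz–Markov–Kakutani theorem, and integrating against a dense sequence of `C(X, ℝ)` embeds it into
`ℕ → ℝ` (`IDM.compactSpace_and_metrizableSpace`). The probability measures on `H^L` are then compact
as well.

*Lattice structure.* Two models of the same depth can be run in parallel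
(`MPNNModel.exists_parallel`), and a Lipschitz map of the outputs is absorbed into the last layer or
into the readout. Hence both function sets are closed under Lipschitz operations of two real
variables, in particular under `max`, `min` and affine maps, and
`UniformlyDenseInC.of_lipschitz_comp` reduces density to separation of points.

*Separation.* Points of the ball are separated by coordinates. Two points of `H^{L+1}` differ in
their truncation to `H^L`, or in their last measure on `H^L`. In the first case a depth `L` feature
separates them. In the second case the integral of some depth `L` feature does, since these features
are already known to be dense in `C(H^L, ℝ)` and hence determine finite measures
(`exists_integral_feature_ne`). The latter argument also separates probability measures on `H^L`.
-/

noncomputable section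

/-! ### Finite measures on compact metrizable spaces -/

section Measures

variable {X : Type*} [TopologicalSpace X] [CompactSpace X] [MeasurableSpace X]

theorem Continuous.integrable_of_compactSpace [OpensMeasurableSpace X] {E : Type*}
    [NormedAddCommGroup E] [SecondCountableTopology E] {f : X → E} (hf : Continuous f)
    (μ : Measure X) [IsFiniteMeasure μ] : Integrable f μ :=
  let _ : MeasurableSpace E := borel E
  have : BorelSpace E := ⟨rfl⟩
  (BoundedContinuousFunction.mkOfCompact ⟨f, hf⟩).integrable μ

theorem ContinuousMap.continuous_integral_right [OpensMeasurableSpace X]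
    (μ : Measure X) [IsFiniteMeasure μ] : Continuous fun f : C(X, ℝ) ↦ ∫ x, f x ∂μ := by
  refine (LipschitzWith.of_dist_le_mul (K := (μ Set.univ).toNNReal) fun f g ↦ ?_).continuous
  rw [dist_eq_norm, ← integral_sub (f.continuous.integrable_of_compactSpace μ)
    (g.continuous.integrable_of_compactSpace μ), dist_eq_norm, mul_comm]
  exact norm_integral_le_of_norm_le_const (.of_forall fun x ↦ (f - g).norm_coe_le_norm x)

theorem MeasureTheory.Measure.ext_of_dense_of_forall_integral_eq [HasOuterApproxClosed X]
    [BorelSpace X] {S : Set C(X, ℝ)} (hS : Dense S) {μ ν : Measure X} [IsFiniteMeasure μ]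
    [IsFiniteMeasure ν] (h : ∀ f ∈ S, ∫ x, f x ∂μ = ∫ x, f x ∂ν) : μ = ν := by
  refine ext_of_forall_integral_eq_of_IsFiniteMeasure fun f ↦ ?_
  exact congrFun (Continuous.ext_on hS (ContinuousMap.continuous_integral_right μ)
    (ContinuousMap.continuous_integral_right ν) h) f.toContinuousMap

/-- Testing a varying finite measure against a fixed continuous vector-valued function. -/
theorem MeasureTheory.FiniteMeasure.continuous_integral_euclidean [OpensMeasurableSpace X]
    {d : ℕ} {f : X → Euc d} (hf : Continuous f) :
    Continuous fun μ : FiniteMeasure X ↦ ∫ x, f x ∂(μ : Measure X) := by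
  refine (PiLp.homeomorph 2 _).isInducing.continuous_iff.2 (continuous_pi fun i ↦ ?_)
  have hi : Continuous fun x ↦ f x i := (EuclideanSpace.proj (𝕜 := ℝ) i).continuous.comp hf
  have := FiniteMeasure.continuous_integral_boundedContinuousFunction
    (BoundedContinuousFunction.mkOfCompact ⟨_, hi⟩)
  refine this.congr fun μ ↦ ?_
  exact (EuclideanSpace.proj (𝕜 := ℝ) i).integral_comp_comm (hf.integrable_of_compactSpace μ)

end Measures

namespace SubProbMeasure

variable {X : Type} [MeasurableSpace X]

instance (μ : SubProbMeasure X) : IsFiniteMeasure μ.toMeasure :=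
  inferInstanceAs (IsFiniteMeasure (μ.val : Measure X))

theorem toMeasure_injective : Function.Injective (toMeasure (X := X)) :=
  FiniteMeasure.toMeasure_injective.comp Subtype.val_injective

variable [TopologicalSpace X] [CompactSpace X] [BorelSpace X]

theorem continuous_integral {d : ℕ} {f : X → Euc d} (hf : Continuous f) :
    Continuous fun μ : SubProbMeasure X ↦ ∫ x, f x ∂μ.toMeasure :=
  (FiniteMeasure.continuous_integral_euclidean hf).comp continuous_subtype_val

instance [T2Space X] : CompactSpace (SubProbMeasure X) :=
  isCompact_iff_compactSpace.1 (isCompact_setOfPred_finiteMeasure_le_of_compactSpace X 1)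

/-- The integrals against a dense sequence of `C(X, ℝ)` embed the compact space of measures of mass
at most one into `ℕ → ℝ`. -/
instance [TopologicalSpace.MetrizableSpace X] :
    TopologicalSpace.MetrizableSpace (SubProbMeasure X) := by
  let f (n : ℕ) : C(X, ℝ) := TopologicalSpace.denseSeq _ n
  have hcont : Continuous fun (μ : SubProbMeasure X) (n : ℕ) ↦ ∫ x, f n x ∂μ.toMeasure :=
    continuous_pi fun n ↦ (FiniteMeasure.continuous_integral_boundedContinuousFunction
      (BoundedContinuousFunction.mkOfCompact (f n))).comp continuous_subtype_val
  refine (hcont.isClosedEmbedding fun μ ν h ↦ toMeasure_injective ?_).isEmbedding.metrizableSpace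
  refine Measure.ext_of_dense_of_forall_integral_eq (TopologicalSpace.denseRange_denseSeq _) ?_
  rintro _ ⟨n, rfl⟩
  exact congrFun h n

end SubProbMeasure

/-! ### The topology of the spaces of iterated degree measures -/

namespace IDM

variable {p : ℕ} {r : ℝ} {L : ℕ}

theorem compactSpace_and_metrizableSpace (p : ℕ) (r : ℝ) (L : ℕ) :
    CompactSpace (IDM p r L) ∧ TopologicalSpace.MetrizableSpace (IDM p r L) := by
  induction L with
  | zero =>
    exact ⟨inferInstanceAs (CompactSpace (Metric.closedBall (0 : Euc p) r)),
      inferInstanceAs (TopologicalSpace.MetrizableSpace (Metric.closedBall (0 : Euc p) r))⟩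
  | succ L ih =>
    obtain ⟨_, _⟩ := ih
    exact ⟨inferInstanceAs (CompactSpace (IDM p r L × SubProbMeasure (IDM p r L))),
      inferInstanceAs
        (TopologicalSpace.MetrizableSpace (IDM p r L × SubProbMeasure (IDM p r L)))⟩

instance : CompactSpace (IDM p r L) := (compactSpace_and_metrizableSpace p r L).1

instance : TopologicalSpace.MetrizableSpace (IDM p r L) :=
  (compactSpace_and_metrizableSpace p r L).2

theorem continuous_attr : Continuous (attr (p := p) (r := r)) := continuous_subtype_val

theorem attr_injective : Function.Injective (attr (p := p) (r := r)) := Subtype.val_injective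

theorem continuous_trunc : Continuous (trunc (p := p) (r := r) (L := L)) :=
  continuous_fst (X := IDM p r L) (Y := SubProbMeasure (IDM p r L))

theorem continuous_last : Continuous (last (p := p) (r := r) (L := L)) :=
  continuous_snd (X := IDM p r L) (Y := SubProbMeasure (IDM p r L))

theorem ext_of_trunc_of_last {σ τ : IDM p r (L + 1)} (h₁ : σ.trunc = τ.trunc)
    (h₂ : σ.last = τ.last) : σ = τ :=
  Prod.ext (α := IDM p r L) (β := SubProbMeasure (IDM p r L)) h₁ h₂

end IDM

/-! ### Stone–Weierstrass for sets closed under Lipschitz operations -/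

/-- A version of the Stone–Weierstrass theorem. Closure under Lipschitz functions of two variables
contains closure under `max` and `min`, and closure under affine functions makes separation of
points strong, so the lattice form of the theorem applies; no products are needed. -/
theorem UniformlyDenseInC.of_lipschitz_comp {X : Type} [TopologicalSpace X] [CompactSpace X]
    {S : Set (X → ℝ)} (hcont : ∀ g ∈ S, Continuous g) (hne : S.Nonempty)
    (hcomp : ∀ g ∈ S, ∀ h ∈ S, ∀ G : ℝ × ℝ → ℝ, (∃ K, LipschitzWith K G) →
      (fun x ↦ G (g x, h x)) ∈ S)
    (hsep : ∀ x y, x ≠ y → ∃ g ∈ S, g x ≠ g y) : UniformlyDenseInC S := by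
  have haffine (g) (hg : g ∈ S) (a b : ℝ) : (fun x ↦ a * g x + b) ∈ S := by
    refine hcomp g hg g hg (fun z ↦ a * z.1 + b) ⟨‖a‖₊, ?_⟩
    refine LipschitzWith.of_dist_le_mul fun z w ↦ ?_
    rw [dist_add_right, Real.dist_eq, ← mul_sub, abs_mul, ← Real.dist_eq]
    exact mul_le_mul_of_nonneg_left (le_max_left _ _) (abs_nonneg a)
  refine ⟨hcont, fun F hF ε hε ↦ ?_⟩
  have hdense := ContinuousMap.sublattice_closure_eq_top {f : C(X, ℝ) | ⇑f ∈ S}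
    (let ⟨g, hg⟩ := hne; ⟨⟨g, hcont g hg⟩, hg⟩)
    (fun f hf g hg ↦ hcomp f hf g hg _ ⟨1, lipschitzWith_min⟩)
    (fun f hf g hg ↦ hcomp f hf g hg _ ⟨1, lipschitzWith_max⟩) ?_
  · obtain ⟨g, hg, hgF⟩ := Metric.mem_closure_iff.1
      (hdense ▸ Set.mem_univ _ : (⟨F, hF⟩ : C(X, ℝ)) ∈ closure {f : C(X, ℝ) | ⇑f ∈ S}) ε hε
    exact ⟨g, hg, fun x ↦ ((ContinuousMap.dist_apply_le_dist x).trans_eq (dist_comm _ _)).trans_lt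
      hgF⟩
  · intro v x y
    by_cases hxy : x = y
    · obtain ⟨g, hg⟩ := hne
      exact ⟨⟨_, hcont _ (haffine g hg 0 (v x))⟩, haffine g hg 0 (v x), by simp, by simp [hxy]⟩
    -- The affine function sending `g x` to `v x` and `g y` to `v y`.
    · obtain ⟨g, hg, hgxy⟩ := hsep x y hxy
      have := haffine g hg ((v x - v y) / (g x - g y)) (v x - (v x - v y) / (g x - g y) * g x)
      refine ⟨⟨_, hcont _ this⟩, this, by simp, ?_⟩
      have : g x - g y ≠ 0 := sub_ne_zero.2 hgxy
      simp only [ContinuousMap.coe_mk]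
      field_simp
      ring

theorem UniformlyDenseInC.dense {X : Type} [TopologicalSpace X] [CompactSpace X]
    {S : Set (X → ℝ)} (hS : UniformlyDenseInC S) : Dense {f : C(X, ℝ) | ⇑f ∈ S} := by
  refine Metric.dense_iff.2 fun F ε hε ↦ ?_
  obtain ⟨g, hg, hgF⟩ := hS.2 F F.continuous ε hε
  exact ⟨⟨g, hS.1 g hg⟩, (ContinuousMap.dist_lt_iff hε).2 hgF, hg⟩

/-! ### Closure properties of message passing networks -/

/-- The isometry `ℝ → ℝ^1` inverse to `x ↦ x 0`. -/
def toEucOne (a : ℝ) : Euc 1 := EuclideanSpace.single 0 a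

theorem lipschitzWith_toEucOne : LipschitzWith 1 toEucOne :=
  LipschitzWith.of_dist_le_mul fun a b ↦ by simp [toEucOne]

theorem lipschitzWith_eval {d : ℕ} (i : Fin d) : ∃ K, LipschitzWith K fun x : Euc d ↦ x i :=
  ⟨_, (EuclideanSpace.proj (𝕜 := ℝ) i).lipschitz⟩

namespace MPNNModel

variable {p : ℕ} {r : ℝ} {L d d' : ℕ}

theorem continuous_feature (r : ℝ) {L d : ℕ} (φ : MPNNModel p L d) :
    Continuous (φ.feature r) := by
  induction φ with
  | init φ₀ lip => exact lip.choose_spec.continuous.comp IDM.continuous_attr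
  | layer φ u lip ih =>
    exact lip.choose_spec.continuous.comp <| (WithLp.prod_continuous_toLp 2 _ _).comp <|
      (ih.comp IDM.continuous_trunc).prodMk
        ((SubProbMeasure.continuous_integral ih).comp IDM.continuous_last)

theorem integrable_feature (φ : MPNNModel p L d) (μ : Measure (IDM p r L)) [IsFiniteMeasure μ] :
    Integrable (φ.feature r) μ :=
  (φ.continuous_feature r).integrable_of_compactSpace μ

instance (p L d : ℕ) : Nonempty (MPNNModel p L d) := by
  induction L generalizing d with
  | zero => exact ⟨.init (fun _ ↦ 0) ⟨0, LipschitzWith.const 0⟩⟩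
  | succ L ih => exact ⟨.layer (ih 0).some (fun _ ↦ 0) ⟨0, LipschitzWith.const 0⟩⟩

theorem integral_map_feature (φ : MPNNModel p L d) (l : Euc d →L[ℝ] Euc d')
    (μ : Measure (IDM p r L)) [IsFiniteMeasure μ] :
    ∫ σ, l (φ.feature r σ) ∂μ = l (∫ σ, φ.feature r σ ∂μ) :=
  l.integral_comp_comm (φ.integrable_feature μ)

/-- A Lipschitz map applied to the output of a model is absorbed into its last layer. -/
theorem exists_feature_eq_comp (r : ℝ) (φ : MPNNModel p L d) {G : Euc d → Euc d'}
    (hG : ∃ K, LipschitzWith K G) :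
    ∃ χ : MPNNModel p L d', ∀ τ, χ.feature r τ = G (φ.feature r τ) := by
  obtain ⟨K, hK⟩ := hG
  cases φ with
  | init φ₀ hφ =>
    obtain ⟨M, hM⟩ := hφ
    exact ⟨.init (G ∘ φ₀) ⟨_, hK.comp hM⟩, fun τ ↦ rfl⟩
  | layer φ u hu =>
    obtain ⟨M, hM⟩ := hu
    exact ⟨.layer φ (G ∘ u) ⟨_, hK.comp hM⟩, fun τ ↦ rfl⟩

/-- Two models of the same depth run in parallel, with concatenated hidden states. The two outputs
are recovered from the joint one by linear maps, which commute with the integrals in the layers. -/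
theorem exists_parallel (r : ℝ) (φ : MPNNModel p L d) (φ' : MPNNModel p L d') :
    ∃ (n : ℕ) (χ : MPNNModel p L n) (l : Euc n →L[ℝ] Euc d) (l' : Euc n →L[ℝ] Euc d'),
      (∀ τ, φ.feature r τ = l (χ.feature r τ)) ∧ ∀ τ, φ'.feature r τ = l' (χ.feature r τ) := by
  let e : Euc (d + d') ≃L[ℝ] Euc d × Euc d' := EuclideanSpace.finAddEquivProd
  suffices h : ∃ χ : MPNNModel p L (d + d'),
      ∀ τ, χ.feature r τ = e.symm (φ.feature r τ, φ'.feature r τ) by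
    obtain ⟨χ, hχ⟩ := h
    exact ⟨_, χ, (ContinuousLinearMap.fst ℝ _ _).comp e.toContinuousLinearMap,
      (ContinuousLinearMap.snd ℝ _ _).comp e.toContinuousLinearMap,
      fun τ ↦ by simp [hχ], fun τ ↦ by simp [hχ]⟩
  induction L generalizing d d' with
  | zero =>
    cases φ with | init φ₀ hφ =>
    cases φ' with | init φ₀' hφ' =>
    obtain ⟨M, hM⟩ := hφ
    obtain ⟨M', hM'⟩ := hφ'
    exact ⟨.init (fun x ↦ e.symm (φ₀ x, φ₀' x)) ⟨_, e.symm.lipschitz.comp (hM.prodMk hM')⟩,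
      fun τ ↦ rfl⟩
  | succ L ih =>
    cases φ with | @layer _ n _ φ u hu =>
    cases φ' with | @layer _ n' _ φ' u' hu' =>
    obtain ⟨M, hM⟩ := hu
    obtain ⟨M', hM'⟩ := hu'
    let e₀ : Euc (n + n') ≃L[ℝ] Euc n × Euc n' := EuclideanSpace.finAddEquivProd
    obtain ⟨χ, hχ⟩ := ih φ φ'
    let l : Euc (n + n') →L[ℝ] Euc n :=
      (ContinuousLinearMap.fst ℝ _ _).comp e₀.toContinuousLinearMap
    let l' : Euc (n + n') →L[ℝ] Euc n' :=
      (ContinuousLinearMap.snd ℝ _ _).comp e₀.toContinuousLinearMap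
    have hl (σ) : φ.feature r σ = l (χ.feature r σ) := by simp [l, e₀, hχ]
    have hl' (σ) : φ'.feature r σ = l' (χ.feature r σ) := by simp [l', e₀, hχ]
    -- `m f` applies `f` to both the state and the aggregated message.
    let m {k k' : ℕ} (f : Euc k →L[ℝ] Euc k') :
        WithLp 2 (Euc k × Euc k) →L[ℝ] WithLp 2 (Euc k' × Euc k') :=
      (WithLp.prodContinuousLinearEquiv 2 ℝ _ _).symm.toContinuousLinearMap ∘L (f.prodMap f) ∘L
        (WithLp.prodContinuousLinearEquiv 2 ℝ _ _).toContinuousLinearMap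
    refine ⟨.layer χ (fun z ↦ e.symm (u (m l z), u' (m l' z)))
      ⟨_, e.symm.lipschitz.comp
        ((hM.comp (m l).lipschitz).prodMk (hM'.comp (m l').lipschitz))⟩, fun τ ↦ ?_⟩
    simp only [feature, hl, hl', integral_map_feature]
    rfl

end MPNNModel

section

variable {p : ℕ} {r : ℝ} {L : ℕ}

theorem mpnnFunctions_comp_mem {G : ℝ × ℝ → ℝ} (hG : ∃ K, LipschitzWith K G)
    {g h : IDM p r L → ℝ} (hg : g ∈ mpnnFunctions p r L) (hh : h ∈ mpnnFunctions p r L) :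
    (fun τ ↦ G (g τ, h τ)) ∈ mpnnFunctions p r L := by
  obtain ⟨φ, hφ⟩ := hg
  obtain ⟨φ', hφ'⟩ := hh
  obtain ⟨n, χ, l, l', hl, hl'⟩ := φ.exists_parallel r φ'
  obtain ⟨K, hK⟩ := hG
  obtain ⟨M, hM⟩ := lipschitzWith_eval (0 : Fin 1)
  obtain ⟨χ', hχ'⟩ := χ.exists_feature_eq_comp r (G := fun z ↦ toEucOne (G (l z 0, l' z 0)))
    ⟨_, lipschitzWith_toEucOne.comp <|
      hK.comp ((hM.comp l.lipschitz).prodMk (hM.comp l'.lipschitz))⟩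
  exact ⟨χ', fun τ ↦ by simp [hχ', hφ, hφ', hl, hl', toEucOne]⟩

theorem mpnnReadoutFunctions_comp_mem {G : ℝ × ℝ → ℝ} (hG : ∃ K, LipschitzWith K G)
    {g h : DIDM p r L → ℝ} (hg : g ∈ mpnnReadoutFunctions p r L)
    (hh : h ∈ mpnnReadoutFunctions p r L) :
    (fun ν ↦ G (g ν, h ν)) ∈ mpnnReadoutFunctions p r L := by
  obtain ⟨d, φ, ψ, ⟨M, hM⟩, hφ⟩ := hg
  obtain ⟨d', φ', ψ', ⟨M', hM'⟩, hφ'⟩ := hh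
  obtain ⟨n, χ, l, l', hl, hl'⟩ := φ.exists_parallel r φ'
  obtain ⟨K, hK⟩ := hG
  obtain ⟨N, hN⟩ := lipschitzWith_eval (0 : Fin 1)
  refine ⟨n, χ, fun z ↦ toEucOne (G (ψ (l z) 0, ψ' (l' z) 0)),
    ⟨_, lipschitzWith_toEucOne.comp <| hK.comp
      ((hN.comp (hM.comp l.lipschitz)).prodMk (hN.comp (hM'.comp l'.lipschitz)))⟩, fun ν ↦ ?_⟩
  simp only [hφ, hφ', MPNNModel.output, hl, hl', MPNNModel.integral_map_feature]
  simp [toEucOne]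

theorem continuous_of_mem_mpnnFunctions {g : IDM p r L → ℝ} (hg : g ∈ mpnnFunctions p r L) :
    Continuous g := by
  obtain ⟨φ, hφ⟩ := hg
  rw [funext hφ]
  exact (lipschitzWith_eval 0).choose_spec.continuous.comp (φ.continuous_feature r)

theorem continuous_of_mem_mpnnReadoutFunctions {g : DIDM p r L → ℝ}
    (hg : g ∈ mpnnReadoutFunctions p r L) : Continuous g := by
  obtain ⟨d, φ, ψ, ⟨K, hK⟩, hφ⟩ := hg
  rw [funext hφ]
  exact (lipschitzWith_eval 0).choose_spec.continuous.comp <| hK.continuous.comp <|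
    (FiniteMeasure.continuous_integral_euclidean (φ.continuous_feature r)).comp
      ProbabilityMeasure.toFiniteMeasure_continuous

/-! ### Separation of points -/

/-- If the scalar features of depth `L` are uniformly dense, their integrals determine a finite
measure on `H^L`. -/
theorem exists_integral_feature_ne (hL : UniformlyDenseInC (mpnnFunctions p r L))
    {μ ν : Measure (IDM p r L)} [IsFiniteMeasure μ] [IsFiniteMeasure ν] (hμν : μ ≠ ν) :
    ∃ φ : MPNNModel p L 1, (∫ σ, φ.feature r σ ∂μ) 0 ≠ (∫ σ, φ.feature r σ ∂ν) 0 := by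
  by_contra! h
  refine hμν (Measure.ext_of_dense_of_forall_integral_eq hL.dense ?_)
  rintro f ⟨φ, hφ⟩
  have key (ρ : Measure (IDM p r L)) [IsFiniteMeasure ρ] :
      ∫ σ, f σ ∂ρ = (∫ σ, φ.feature r σ ∂ρ) 0 := by
    simp only [hφ]
    exact (EuclideanSpace.proj (𝕜 := ℝ) 0).integral_comp_comm (φ.integrable_feature ρ)
  rw [key, key, h]

theorem exists_mpnnFunctions_zero_ne {σ τ : IDM p r 0} (h : σ ≠ τ) :
    ∃ g ∈ mpnnFunctions p r 0, g σ ≠ g τ := by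
  obtain ⟨i, hi⟩ : ∃ i, σ.attr i ≠ τ.attr i := by
    by_contra! h'
    exact h (IDM.attr_injective (PiLp.ext h'))
  obtain ⟨K, hK⟩ := lipschitzWith_eval i
  exact ⟨fun ρ ↦ ρ.attr i, ⟨.init (fun x ↦ toEucOne (x i)) ⟨_, lipschitzWith_toEucOne.comp hK⟩,
    fun ρ ↦ by simp [MPNNModel.feature, toEucOne]⟩, hi⟩

/-- Distinct iterated degree measures of order `L + 1` differ in the truncation or in the last
measure; the last layer reads off the first or the second argument accordingly. -/
theorem exists_mpnnFunctions_succ_ne (hL : UniformlyDenseInC (mpnnFunctions p r L))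
    (hsep : ∀ σ τ : IDM p r L, σ ≠ τ → ∃ g ∈ mpnnFunctions p r L, g σ ≠ g τ)
    {σ τ : IDM p r (L + 1)} (h : σ ≠ τ) :
    ∃ g ∈ mpnnFunctions p r (L + 1), g σ ≠ g τ := by
  by_cases htrunc : σ.trunc = τ.trunc
  · obtain ⟨φ, hφ⟩ := exists_integral_feature_ne hL
      (SubProbMeasure.toMeasure_injective.ne fun hlast ↦ h (IDM.ext_of_trunc_of_last htrunc hlast))
    exact ⟨_, ⟨.layer φ (WithLp.sndL 2 ℝ _ _) ⟨_, ContinuousLinearMap.lipschitz _⟩,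
      fun _ ↦ rfl⟩, hφ⟩
  · obtain ⟨g, ⟨φ, hφ⟩, hg⟩ := hsep _ _ htrunc
    rw [hφ, hφ] at hg
    exact ⟨_, ⟨.layer φ (WithLp.fstL 2 ℝ _ _) ⟨_, ContinuousLinearMap.lipschitz _⟩,
      fun _ ↦ rfl⟩, hg⟩

/-! ### Density -/

theorem uniformlyDenseInC_mpnnFunctions_of_separates
    (hsep : ∀ σ τ : IDM p r L, σ ≠ τ → ∃ g ∈ mpnnFunctions p r L, g σ ≠ g τ) :
    UniformlyDenseInC (mpnnFunctions p r L) :=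
  .of_lipschitz_comp (fun _ ↦ continuous_of_mem_mpnnFunctions)
    ⟨_, (Classical.arbitrary (MPNNModel p L 1)), fun _ ↦ rfl⟩
    (fun _ hg _ hh _ hG ↦ mpnnFunctions_comp_mem hG hg hh) hsep

/-- Separation of points and density at each order feed the separation of points at the next. -/
theorem mpnnFunctions_separates (p : ℕ) (r : ℝ) (L : ℕ) :
    ∀ σ τ : IDM p r L, σ ≠ τ → ∃ g ∈ mpnnFunctions p r L, g σ ≠ g τ := by
  induction L with
  | zero => exact fun _ _ ↦ exists_mpnnFunctions_zero_ne
  | succ L ih =>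
    exact fun _ _ ↦ exists_mpnnFunctions_succ_ne
      (uniformlyDenseInC_mpnnFunctions_of_separates ih) ih

theorem uniformlyDenseInC_mpnnFunctions (p : ℕ) (r : ℝ) (L : ℕ) :
    UniformlyDenseInC (mpnnFunctions p r L) :=
  uniformlyDenseInC_mpnnFunctions_of_separates (mpnnFunctions_separates p r L)

theorem uniformlyDenseInC_mpnnReadoutFunctions (p : ℕ) (r : ℝ) (L : ℕ) :
    UniformlyDenseInC (mpnnReadoutFunctions p r L) := by
  refine .of_lipschitz_comp (fun _ ↦ continuous_of_mem_mpnnReadoutFunctions)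
    ⟨_, 1, Classical.arbitrary _, id, ⟨1, LipschitzWith.id⟩, fun _ ↦ rfl⟩
    (fun _ hg _ hh _ hG ↦ mpnnReadoutFunctions_comp_mem hG hg hh) fun μ ν hμν ↦ ?_
  obtain ⟨φ, hφ⟩ := exists_integral_feature_ne (uniformlyDenseInC_mpnnFunctions p r L)
    (ProbabilityMeasure.toMeasure_injective.ne hμν)
  exact ⟨_, ⟨1, φ, id, ⟨1, LipschitzWith.id⟩, fun _ ↦ rfl⟩, hφ⟩

end

theorem mainTheorem1 (p : ℕ) (r : ℝ) (hr : 0 < r) (L : ℕ) :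
    UniformlyDenseInC (mpnnFunctions p r L) ∧
      UniformlyDenseInC (mpnnReadoutFunctions p r L) :=
  ⟨uniformlyDenseInC_mpnnFunctions p r L, uniformlyDenseInC_mpnnReadoutFunctions p r L⟩
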